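/- Write $[\omega]^\omega$ for the set of infinite subsets of $\omega$, and let $\square_{\text{1-1}}$ be the set of injective functions $f\colon\omega\to\omega$ without fixed points. Define $$\Delta_{\text{1-1}}=\min\{|\mathcal F| : \mathcal F\subseteq\square_{\text{1-1}}\text{ and }\forall A\in[\omega]^\omega\ \exists f\in\mathcal F\ (f[A]\cap A\text{ is infinite})\},$$ $$\mathfrak{ros}_{\text{1-1}}=\min\{|\mathcal A| : \mathcal A\subseteq[\omega]^\omega\text{ and }\forall f\in\square_{\text{1-1}}\ \exists A\in\mathcal A\ (f[A]\cap A\text{ is finite})\}.$$ Let $\mathfrak b,\mathfrak d,\mathfrak s,\mathfrak r$ be the bounding, dominating, splitting and reaping numbers, and let $\mathcal M$ and $\mathcal N$ be the ideals of meager and of Lebesgue null subsets of $\mathbb R$. For an ideal $\mathcal I$ of subsets of $\mathbb R$, $\mathrm{cov}(\mathcal I)$ is the least size of a subfamily of $\mathcal I$ with union $\mathbb R$, and $\mathrm{non}(\mathcal I)$ is the least size of a subset of $\mathbb R$ not in $\mathcal I$. Then $$\max\{\mathfrak b,\mathfrak s,\mathrm{cov}(\mathcal N)\}\le\Delta_{\text{1-1}}\le\mathrm{non}(\mathcal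 M)$$ and $$\mathrm{cov}(\mathcal M)\le\mathfrak{ros}_{\text{1-1}}\le\min\{\mathfrak d,\mathfrak r,\mathrm{non}(\mathcal N)\}.$$ -/

import Mathlib

namespace CardChar

/-- The dominating number of a relational system: the least size of a set of elements of `β`
such that every element of `α` is related to one of them. -/
noncomputable def domNumber {α β : Type} (R : α → β → Prop) : Cardinal.{0} :=
  sInf {κ | ∃ Y : Set β, (∀ a : α, ∃ b ∈ Y, R a b) ∧ Cardinal.mk Y = κ}

/-- The bounding number of a relational system: the least size of a set of elements of `α`
that are not all related to one common element of `β`. -/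
noncomputable def unbNumber {α β : Type} (R : α → β → Prop) : Cardinal.{0} :=
  sInf {κ | ∃ X : Set α, (¬ ∃ b : β, ∀ a ∈ X, R a b) ∧ Cardinal.mk X = κ}

/-- The infinite subsets of the natural numbers. -/
abbrev InfSet : Type := {A : Set ℕ // A.Infinite}

/-- Eventual domination of functions. -/
def LeStar (f g : ℕ → ℕ) : Prop := ∀ᶠ n in Filter.atTop, f n ≤ g n

/-- `S` splits `A` when both `A ∩ S` and `A \ S` are infinite. -/
def Splits (S A : Set ℕ) : Prop := (A ∩ S).Infinite ∧ (A \ S).Infinite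

/-- The relation underlying the splitting and the reaping number. -/
def NotSplits (S : Set ℕ) (A : InfSet) : Prop := ¬ Splits S A.1

/-- The bounding number. -/
noncomputable def bNumber : Cardinal.{0} := unbNumber LeStar

/-- The dominating number. -/
noncomputable def dNumber : Cardinal.{0} := domNumber LeStar

/-- The splitting number. -/
noncomputable def sNumber : Cardinal.{0} := unbNumber NotSplits

/-- The reaping number. -/
noncomputable def rNumber : Cardinal.{0} := domNumber NotSplits

/-- The covering number of a family `I` of sets of reals. -/
noncomputable def cov (I : Set (Set ℝ)) : Cardinal.{0} :=
  sInf {κ | ∃ C : Set (Set ℝ), C ⊆ I ∧ ⋃₀ C = Set.univ ∧ Cardinal.mk C = κ}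

/-- The uniformity number of a family `I` of sets of reals. -/
noncomputable def non (I : Set (Set ℝ)) : Cardinal.{0} :=
  sInf {κ | ∃ X : Set ℝ, X ∉ I ∧ Cardinal.mk X = κ}

/-- The ideal of meager sets of reals. -/
def meagerIdeal : Set (Set ℝ) := {s | IsMeagre s}

/-- The ideal of Lebesgue null sets of reals. -/
def nullIdeal : Set (Set ℝ) := {s | MeasureTheory.volume s = 0}

/-- The functions without fixed points that satisfy `φ`. -/
abbrev Square (φ : (ℕ → ℕ) → Prop) : Type := {f : ℕ → ℕ // (∀ n, f n ≠ n) ∧ φ f}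

/-- `A` is *-free for `f` when `f[A] ∩ A` is finite. -/
def StarFree (φ : (ℕ → ℕ) → Prop) (f : Square φ) (A : InfSet) : Prop :=
  (f.1 '' A.1 ∩ A.1).Finite

/-- The least size of a family of infinite sets that contains, for every `f` in `Square φ`,
a set which is *-free for `f`. -/
noncomputable def ros (φ : (ℕ → ℕ) → Prop) : Cardinal.{0} := domNumber (StarFree φ)

/-- The least size of a subfamily of `Square φ` for which no infinite set is simultaneously
*-free for all members. -/
noncomputable def delta (φ : (ℕ → ℕ) → Prop) : Cardinal.{0} := unbNumber (StarFree φ)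

end CardChar

/-!
Each inequality compares the relation `StarFree Function.Injective` with a relation that defines a
classical invariant, and one construction serves a bound on `delta` and the dual bound on `ros`.

* Domination (`starFree_sparseSet`): if `g` eventually bounds `f` and its inverse, then a set `A`
  with `g x < y` for all `x < y` in `A` is `*`-free for `f`.
* Splitting (`greedyColoring`): the graph with edges `{n, f n}` has degree at most two, so it has a
  proper 3-colouring, and a set almost contained in one colour class is `*`-free. An infinite set
  split by no colour class is of this kind, which handles `𝔰`; applying a reaping family twice
  produces such a set, which handles `𝔯`. The passage from one colour class to three costs a finite
  factor or a square, harmless because neither invariant is attained by a finite family.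
* Measure (`not_starFree_randomSet_mem_nullIdeal`): choose one point at random from each of
  countably many disjoint blocks, whose sizes grow so fast that the sum over `j` of the total size of
  the blocks before the `j`-th over the size of the `j`-th converges. By the Borel–Cantelli lemma
  only finitely many chosen points are almost surely connected by a given injection `f`. The blocks
  are `[2 ^ j ^ 2, 2 ^ (j ^ 2 + 1))`, and rounding `(1 + fract r) * 2 ^ j ^ 2` chooses the points.
* Category (`starFree_genericSquare_mem_meagerIdeal`): a real `r` codes a function `h` that takes
  arbitrary values at two given large places `a < b`, one after the other, on some subinterval of
  any given interval. Interchange `a` and `b` when `h a = b` and `h b = a`, a condition under which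
  different pairs never conflict; generically infinitely many points remain, and a copy of the
  successor function on these completes the interchanges to an injection without fixed points.
  For generic `r`, this injection interchanges infinitely many pairs in any given infinite set.
-/

namespace CardChar

open Set Filter MeasureTheory Topology

/-! ### Comparing cardinal characteristics -/

section Comparison

variable {α β α' β' : Type} {R : α → β → Prop} {R' : α' → β' → Prop} {I : Set (Set ℝ)}

/-- The bounding number is the dominating number of the dual relation, so each comparison below
is proved for dominating numbers only. -/
lemma unbNumber_eq_domNumber_dual (R : α → β → Prop) :
    unbNumber R = domNumber fun b a => ¬ R a b := by
  simp only [unbNumber, domNumber, not_exists, not_forall, exists_prop]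

lemma domNumber_le_mk {Y : Set β} (hY : ∀ a, ∃ b ∈ Y, R a b) : domNumber R ≤ Cardinal.mk Y :=
  csInf_le' ⟨Y, hY, rfl⟩

lemma unbNumber_le_mk {X : Set α} (hX : ¬ ∃ b, ∀ a ∈ X, R a b) : unbNumber R ≤ Cardinal.mk X :=
  csInf_le' ⟨X, hX, rfl⟩

lemma cov_le_mk {C : Set (Set ℝ)} (hC : C ⊆ I) (hcov : ⋃₀ C = univ) : cov I ≤ Cardinal.mk C :=
  csInf_le' ⟨C, hC, hcov, rfl⟩

/-- A Tukey connection `(φ, ψ)` from `R` to `R'` compares dominating numbers. Totality of `R'`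
excludes the value `sInf ∅ = 0` on the right. -/
lemma domNumber_le_domNumber (φ : α → α') (ψ : β' → β)
    (h : ∀ a b', R' (φ a) b' → R a (ψ b')) (htot : ∀ a', ∃ b', R' a' b') :
    domNumber R ≤ domNumber R' := by
  refine le_csInf ⟨_, univ, fun a => ?_, rfl⟩ ?_
  · simpa using htot a
  · rintro _ ⟨Y, hY, rfl⟩
    refine (domNumber_le_mk (Y := ψ '' Y) fun a => ?_).trans Cardinal.mk_image_le
    obtain ⟨b', hb', hR⟩ := hY (φ a)
    exact ⟨ψ b', mem_image_of_mem ψ hb', h a b' hR⟩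

lemma unbNumber_le_unbNumber (φ : α → α') (ψ : β' → β)
    (h : ∀ a b', R' (φ a) b' → R a (ψ b')) (hunb : ∀ b, ∃ a, ¬ R a b) :
    unbNumber R' ≤ unbNumber R := by
  rw [unbNumber_eq_domNumber_dual, unbNumber_eq_domNumber_dual]
  exact domNumber_le_domNumber ψ φ (fun b' a => mt (h a b')) hunb

lemma cov_le_domNumber (φ : ℝ → α) (h : ∀ b, {r | R (φ r) b} ∈ I) (htot : ∀ a, ∃ b, R a b) :
    cov I ≤ domNumber R := by
  refine le_csInf ⟨_, univ, fun a => ?_, rfl⟩ ?_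
  · simpa using htot a
  · rintro _ ⟨Y, hY, rfl⟩
    refine (cov_le_mk (C := (fun b => {r | R (φ r) b}) '' Y) ?_ ?_).trans Cardinal.mk_image_le
    · rintro _ ⟨b, -, rfl⟩
      exact h b
    · refine eq_univ_of_forall fun r => ?_
      obtain ⟨b, hb, hR⟩ := hY (φ r)
      exact ⟨_, mem_image_of_mem _ hb, hR⟩

lemma domNumber_le_non (hI : ∀ s ∈ I, ∀ t ⊆ s, t ∈ I) (huniv : univ ∉ I) (ψ : ℝ → β)
    (h : ∀ a, {r | ¬ R a (ψ r)} ∈ I) : domNumber R ≤ non I := by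
  refine le_csInf ⟨_, univ, huniv, rfl⟩ ?_
  rintro _ ⟨X, hX, rfl⟩
  refine (domNumber_le_mk (Y := ψ '' X) fun a => ?_).trans Cardinal.mk_image_le
  by_contra! hcon
  exact hX (hI _ (h a) X fun r hr => hcon _ (mem_image_of_mem ψ hr))

lemma cov_le_unbNumber (ψ : ℝ → β) (h : ∀ a, {r | ¬ R a (ψ r)} ∈ I) (hunb : ∀ b, ∃ a, ¬ R a b) :
    cov I ≤ unbNumber R := by
  rw [unbNumber_eq_domNumber_dual]
  exact cov_le_domNumber ψ h hunb

lemma unbNumber_le_non (hI : ∀ s ∈ I, ∀ t ⊆ s, t ∈ I) (huniv : univ ∉ I) (φ : ℝ → α)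
    (h : ∀ b, {r | R (φ r) b} ∈ I) : unbNumber R ≤ non I := by
  rw [unbNumber_eq_domNumber_dual]
  exact domNumber_le_non hI huniv φ (by simpa using h)

end Comparison

/-! ### Domination -/

/-- A bound for the values of `f` and of its inverse. -/
noncomputable def twoSidedBound (f : ℕ → ℕ) (n : ℕ) : ℕ := f n + Function.invFun f n

/-- A sequence whose every term exceeds the value of `g` at the preceding one. -/
def sparseSeq (g : ℕ → ℕ) : ℕ → ℕ
  | 0 => 0
  | k + 1 => sparseSeq g k + g (sparseSeq g k) + 1

lemma strictMono_sparseSeq (g : ℕ → ℕ) : StrictMono (sparseSeq g) :=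
  strictMono_nat_of_lt_succ fun k => by rw [sparseSeq]; omega

/-- The infinite set of the terms of `sparseSeq g`. -/
def sparseSet (g : ℕ → ℕ) : InfSet :=
  ⟨range (sparseSeq g), infinite_range_of_injective (strictMono_sparseSeq g).injective⟩

lemma apply_lt_of_mem_sparseSet {g : ℕ → ℕ} {x y : ℕ} (hx : x ∈ (sparseSet g).1)
    (hy : y ∈ (sparseSet g).1) (hxy : x < y) : g x < y := by
  obtain ⟨i, rfl⟩ := hx
  obtain ⟨j, rfl⟩ := hy
  have hij : i + 1 ≤ j := (strictMono_sparseSeq g).lt_iff_lt.1 hxy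
  have := (strictMono_sparseSeq g).monotone hij
  rw [sparseSeq] at this
  omega

lemma starFree_sparseSet (f : Square Function.Injective) {g : ℕ → ℕ}
    (h : LeStar (twoSidedBound f.1) g) : StarFree _ f (sparseSet g) := by
  obtain ⟨N, hN⟩ := eventually_atTop.1 h
  refine ((finite_Iio N).union ((finite_Iio N).image f.1)).subset ?_
  rintro _ ⟨⟨x, hx, rfl⟩, hy⟩
  by_contra hcon
  simp only [mem_union, mem_Iio, mem_image, not_or, not_lt, not_exists, not_and] at hcon
  have hxN : N ≤ x := by
    by_contra! hlt
    exact hcon.2 x hlt rfl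
  rcases lt_or_gt_of_ne (f.2.1 x) with hlt | hlt
  · have h1 := apply_lt_of_mem_sparseSet hy hx hlt
    have h2 := hN _ hcon.1
    rw [twoSidedBound, Function.leftInverse_invFun f.2.2 x] at h2
    omega
  · have h1 := apply_lt_of_mem_sparseSet hx hy hlt
    have h2 := hN _ hxN
    rw [twoSidedBound] at h2
    omega

lemma exists_starFree (f : Square Function.Injective) : ∃ A, StarFree _ f A :=
  ⟨_, starFree_sparseSet f (Eventually.of_forall fun _ => le_rfl)⟩

lemma ros_le_dNumber : ros Function.Injective ≤ dNumber :=
  domNumber_le_domNumber (fun f => twoSidedBound f.1) sparseSet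
    (fun f _ => starFree_sparseSet f) fun g => ⟨g, Eventually.of_forall fun _ => le_rfl⟩

/-! ### Colourings and splitting -/

lemma exists_ne_ne_fin_three (x y : Fin 3) : ∃ z, z ≠ x ∧ z ≠ y := by
  decide +revert

open Classical in
/-- The greedy colouring of the graph with the edges `{n, f n}`: each `n` avoids the colours of
`f n` and of one `f`-preimage of `n`, as far as these are below `n`. -/
noncomputable def greedyColoring (f : ℕ → ℕ) (n : ℕ) : Fin 3 :=
  (exists_ne_ne_fin_three
    (if _h : f n < n then greedyColoring f (f n) else 0)
    (if h : ∃ m < n, f m = n then greedyColoring f h.choose else 0)).choose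
termination_by n
decreasing_by
  all_goals first | assumption | exact h.choose_spec.1

/-- Injectivity makes the preimage considered by the greedy colouring the only one, so three
colours suffice. -/
lemma greedyColoring_apply_ne {f : ℕ → ℕ} (hf : Function.Injective f) (hfix : ∀ n, f n ≠ n)
    (n : ℕ) : greedyColoring f (f n) ≠ greedyColoring f n := by
  rcases lt_or_gt_of_ne (hfix n) with hlt | hlt
  · conv_rhs => rw [greedyColoring]
    have := (exists_ne_ne_fin_three
      (if _h : f n < n then greedyColoring f (f n) else 0)
      (if h : ∃ m < n, f m = n then greedyColoring f h.choose else 0)).choose_spec.1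
    rw [dif_pos hlt] at this
    simpa only [dif_pos hlt] using this.symm
  · have hex : ∃ m < f n, f m = f n := ⟨n, hlt, rfl⟩
    have hn : hex.choose = n := hf hex.choose_spec.2
    conv_lhs => rw [greedyColoring]
    have := (exists_ne_ne_fin_three
      (if _h : f (f n) < f n then greedyColoring f (f (f n)) else 0)
      (if h : ∃ m < f n, f m = f n then greedyColoring f h.choose else 0)).choose_spec.2
    simpa only [dif_pos hex, hn] using this

/-- A set that is almost contained in one colour class is `*`-free. -/
lemma starFree_of_finite_diff (f : Square Function.Injective) {A : InfSet} {i : Fin 3}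
    (h : (A.1 \ greedyColoring f.1 ⁻¹' {i}).Finite) : StarFree _ f A := by
  refine (h.union (h.image f.1)).subset ?_
  rintro _ ⟨⟨x, hx, rfl⟩, hy⟩
  by_cases hi : greedyColoring f.1 x = i
  · refine Or.inl ⟨hy, fun hfx => ?_⟩
    exact greedyColoring_apply_ne f.2.2 f.2.1 x (Eq.trans hfx hi.symm)
  · exact Or.inr ⟨x, ⟨hx, hi⟩, rfl⟩

lemma starFree_of_forall_notSplits (f : Square Function.Injective) {A : InfSet}
    (h : ∀ i, NotSplits (greedyColoring f.1 ⁻¹' {i}) A) : StarFree _ f A := by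
  obtain ⟨i, hi⟩ : ∃ i, (A.1 ∩ greedyColoring f.1 ⁻¹' {i}).Infinite := by
    by_contra! hcon
    refine A.2 ((finite_iUnion hcon).subset fun x hx => ?_)
    exact mem_iUnion.2 ⟨greedyColoring f.1 x, hx, rfl⟩
  refine starFree_of_finite_diff f (i := i) ?_
  by_contra hinf
  exact h i ⟨hi, hinf⟩

/-- Finitely many sets split no member of a nonprincipal ultrafilter that decides all of them. -/
lemma exists_forall_notSplits_of_finite {X : Set (Set ℕ)} (hX : X.Finite) :
    ∃ A, ∀ S ∈ X, NotSplits S A := by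
  let U : Ultrafilter ℕ := hyperfilter ℕ
  have hinf : ∀ s ∈ U, s.Infinite := fun s hs hfin => notMem_hyperfilter_of_finite hfin hs
  have hex : ∀ S : Set ℕ, ∃ T ∈ U, T ⊆ S ∨ T ⊆ Sᶜ := fun S =>
    (U.mem_or_compl_mem S).elim (fun h => ⟨S, h, Or.inl subset_rfl⟩)
      fun h => ⟨Sᶜ, h, Or.inr subset_rfl⟩
  choose T hTU hT using hex
  refine ⟨⟨⋂ S ∈ X, T S, hinf _ ((biInter_mem hX).2 fun S _ => hTU S)⟩, fun S hS hsplit => ?_⟩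
  have hsub : (⋂ S ∈ X, T S) ⊆ T S := biInter_subset_of_mem hS
  rcases hT S with h | h
  · exact hsplit.2 (by simp [sdiff_eq_empty.2 (hsub.trans h)])
  · refine hsplit.1 ?_
    rw [disjoint_iff_inter_eq_empty.1 (disjoint_left.2 fun x hx => (hsub.trans h) hx)]
    exact finite_empty

/-- The colour classes of an unbounded family form a splitting family of at most three times its
size. -/
lemma sNumber_le_delta (hunb : ∀ A, ∃ f, ¬ StarFree Function.Injective f A) :
    sNumber ≤ delta Function.Injective := by
  refine le_csInf ⟨_, univ, ?_, rfl⟩ ?_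
  · rintro ⟨A, hA⟩
    obtain ⟨f, hf⟩ := hunb A
    exact hf (hA f (mem_univ f))
  rintro _ ⟨F, hF, rfl⟩
  let C : F × Fin 3 → Set ℕ := fun p => greedyColoring p.1.1.1 ⁻¹' {p.2}
  have hC : ¬ ∃ A, ∀ S ∈ range C, NotSplits S A := by
    rintro ⟨A, hA⟩
    exact hF ⟨A, fun f hf => starFree_of_forall_notSplits f fun i => hA _ ⟨(⟨f, hf⟩, i), rfl⟩⟩
  have hinf : Infinite F := by
    by_contra hfin
    have : Finite F := not_infinite_iff_finite.1 hfin
    exact hC (exists_forall_notSplits_of_finite (finite_range C))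
  refine (unbNumber_le_mk hC).trans (Cardinal.mk_range_le.trans ?_)
  rw [Cardinal.mk_prod, Cardinal.lift_id, Cardinal.lift_id]
  exact (Cardinal.mul_eq_left (Cardinal.aleph0_le_mk F)
    ((Cardinal.lt_aleph0_of_finite _).le.trans (Cardinal.aleph0_le_mk F)) (by simp)).le

/-- Finitely many infinite sets are split by one set: the union of every second interval of a
partition into intervals that meet all of them. -/
lemma exists_forall_splits_of_finite {Y : Set InfSet} (hY : Y.Finite) :
    ∃ S, ∀ A ∈ Y, Splits S A.1 := by
  have hg : ∀ n, ∃ k, n < k ∧ ∀ A ∈ Y, ∃ m ∈ A.1, n ≤ m ∧ m < k := by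
    intro n
    choose e heA hen using fun A : InfSet => A.2.exists_gt n
    obtain ⟨B, hB⟩ := (hY.image e).bddAbove
    refine ⟨max n B + 1, by omega, fun A hA => ⟨e A, heA A, (hen A).le, ?_⟩⟩
    have := hB (mem_image_of_mem e hA)
    omega
  choose g hng hg using hg
  let x : ℕ → ℕ := fun k => g^[k] 0
  have hsucc : ∀ k, x (k + 1) = g (x k) := fun k => Function.iterate_succ_apply' g k 0
  have hx : StrictMono x := strictMono_nat_of_lt_succ fun k => by rw [hsucc]; exact hng _
  have hmeet : ∀ A ∈ Y, ∀ k, ∃ m ∈ A.1, x k ≤ m ∧ m < x (k + 1) := fun A hA k => by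
    rw [hsucc]
    exact hg _ A hA
  refine ⟨{m | ∃ k, x (2 * k) ≤ m ∧ m < x (2 * k + 1)}, fun A hA => ⟨?_, ?_⟩⟩
  · refine infinite_of_forall_exists_gt fun N => ?_
    obtain ⟨m, hmA, h1, h2⟩ := hmeet A hA (2 * (N + 1))
    refine ⟨m, ⟨hmA, N + 1, h1, h2⟩, ?_⟩
    have := hx.id_le (2 * (N + 1))
    simp only [id] at this
    omega
  · refine infinite_of_forall_exists_gt fun N => ?_
    obtain ⟨m, hmA, h1, h2⟩ := hmeet A hA (2 * N + 1)
    refine ⟨m, ⟨hmA, ?_⟩, ?_⟩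
    · rintro ⟨k, h3, h4⟩
      have h5 := hx.lt_iff_lt.1 (h3.trans_lt h2)
      have h6 := hx.lt_iff_lt.1 (h1.trans_lt h4)
      omega
    · have := hx.id_le (2 * N + 1)
      simp only [id] at this
      omega

/-- The copy of `B` inside `A` under the increasing enumeration of `A`. -/
noncomputable def copyIn (A B : InfSet) : InfSet :=
  ⟨Nat.nth (· ∈ A.1) '' B.1, B.2.image (Nat.nth_injective A.2).injOn⟩

lemma copyIn_subset (A B : InfSet) : (copyIn A B).1 ⊆ A.1 := by
  rintro _ ⟨k, -, rfl⟩
  exact Nat.nth_mem_of_infinite A.2 k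

/-- Two successive applications of reaping make a set almost homogeneous for three colours. -/
lemma exists_starFree_copyIn (f : Square Function.Injective) {Y : Set InfSet}
    (hY : ∀ S, ∃ A ∈ Y, NotSplits S A) : ∃ A ∈ Y, ∃ B ∈ Y, StarFree _ f (copyIn A B) := by
  let C : Fin 3 → Set ℕ := fun i => greedyColoring f.1 ⁻¹' {i}
  obtain ⟨A, hA, hAC⟩ := hY (C 0)
  -- The colour class `1` is pulled back along the enumeration of `A`, so that `Y` applies inside `A`.
  obtain ⟨B, hB, hBC⟩ := hY (Nat.nth (· ∈ A.1) ⁻¹' C 1)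
  refine ⟨A, hA, B, hB, ?_⟩
  by_cases h0 : (A.1 \ C 0).Finite
  · exact starFree_of_finite_diff f (h0.subset (sdiff_subset_sdiff_left (copyIn_subset A B)))
  by_cases h1 : (B.1 \ Nat.nth (· ∈ A.1) ⁻¹' C 1).Finite
  · refine starFree_of_finite_diff f (i := 1) ((h1.image (Nat.nth (· ∈ A.1))).subset ?_)
    rintro _ ⟨⟨k, hk, rfl⟩, hk'⟩
    exact ⟨k, ⟨hk, hk'⟩, rfl⟩
  have h0' : (A.1 ∩ C 0).Finite := not_infinite.1 fun h => hAC ⟨h, h0⟩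
  have h1' : (B.1 ∩ Nat.nth (· ∈ A.1) ⁻¹' C 1).Finite := not_infinite.1 fun h => hBC ⟨h, h1⟩
  refine starFree_of_finite_diff f (i := 2)
    ((h0'.union (h1'.image (Nat.nth (· ∈ A.1)))).subset ?_)
  rintro x ⟨hx, hx2⟩
  have hcol : greedyColoring f.1 x = 0 ∨ greedyColoring f.1 x = 1 := by
    have hx2' : greedyColoring f.1 x ≠ 2 := hx2
    generalize greedyColoring f.1 x = z at hx2'
    decide +revert
  rcases hcol with hc | hc
  · exact Or.inl ⟨copyIn_subset A B hx, hc⟩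
  · obtain ⟨k, hk, rfl⟩ := hx
    exact Or.inr ⟨k, ⟨hk, hc⟩, rfl⟩

lemma exists_notSplits (S : Set ℕ) : ∃ A, NotSplits S A := by
  obtain ⟨A, hA⟩ := exists_forall_notSplits_of_finite (finite_singleton S)
  exact ⟨A, hA S rfl⟩

lemma ros_le_rNumber : ros Function.Injective ≤ rNumber := by
  refine le_csInf ⟨_, univ, fun S => by simpa using exists_notSplits S, rfl⟩ ?_
  rintro _ ⟨Y, hY, rfl⟩
  have hinf : Infinite Y := by
    by_contra hfin
    obtain ⟨S, hS⟩ := exists_forall_splits_of_finite (not_infinite.1 (mt infinite_coe_iff.2 hfin))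
    obtain ⟨A, hA, hAS⟩ := hY S
    exact hAS (hS A hA)
  refine (domNumber_le_mk (Y := range fun p : Y × Y => copyIn p.1 p.2) fun f => ?_).trans
    (Cardinal.mk_range_le.trans ?_)
  · obtain ⟨A, hA, B, hB, h⟩ := exists_starFree_copyIn f hY
    exact ⟨_, ⟨(⟨A, hA⟩, ⟨B, hB⟩), rfl⟩, h⟩
  · rw [Cardinal.mk_prod, Cardinal.lift_id]
    exact (Cardinal.mul_eq_self (Cardinal.aleph0_le_mk Y)).le

/-! ### Random sparse sets -/

/-- A point of the block `[2 ^ j ^ 2, 2 ^ (j ^ 2 + 1))`, uniformly distributed for `r` uniform on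
a unit interval. -/
noncomputable def randomPoint (r : ℝ) (j : ℕ) : ℕ := ⌊(1 + Int.fract r) * 2 ^ j ^ 2⌋₊

lemma two_pow_le_randomPoint (r : ℝ) (j : ℕ) : 2 ^ j ^ 2 ≤ randomPoint r j := by
  refine Nat.le_floor ?_
  push_cast
  exact le_mul_of_one_le_left (by positivity) (by linarith [Int.fract_nonneg r])

lemma randomPoint_lt_two_pow (r : ℝ) (j : ℕ) : randomPoint r j < 2 ^ (j ^ 2 + 1) := by
  refine (Nat.floor_lt' (by positivity)).2 ?_
  push_cast
  rw [pow_succ (2 : ℝ) (j ^ 2), mul_comm ((2 : ℝ) ^ j ^ 2)]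
  gcongr
  linarith [Int.fract_lt_one r]

lemma randomPoint_lt_of_lt (r : ℝ) {i j : ℕ} (hij : i < j) :
    randomPoint r i < 2 ^ ((j - 1) ^ 2 + 1) :=
  (randomPoint_lt_two_pow r i).trans_le
    (Nat.pow_le_pow_right two_pos (by gcongr; omega))

lemma strictMono_randomPoint (r : ℝ) : StrictMono (randomPoint r) := by
  refine strictMono_nat_of_lt_succ fun j => ?_
  refine (randomPoint_lt_two_pow r j).trans_le (le_trans ?_ (two_pow_le_randomPoint r (j + 1)))
  exact Nat.pow_le_pow_right two_pos (by nlinarith [Nat.zero_le j])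

/-- The infinite set of the points `randomPoint r j`. -/
noncomputable def randomSet (r : ℝ) : InfSet :=
  ⟨range (randomPoint r), infinite_range_of_injective (strictMono_randomPoint r).injective⟩

lemma volume_randomPoint_eq_le (m : ℤ) (j y : ℕ) :
    volume ({r | randomPoint r j = y} ∩ Ico (m : ℝ) (m + 1)) ≤ ENNReal.ofReal ((1 / 2) ^ j ^ 2) := by
  have hsub : {r | randomPoint r j = y} ∩ Ico (m : ℝ) (m + 1) ⊆
      Ico (m - 1 + y * (1 / 2) ^ j ^ 2 : ℝ) (m - 1 + (y + 1) * (1 / 2) ^ j ^ 2) := by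
    rintro r ⟨hr, hm⟩
    have hfl : ⌊r⌋ = m := Int.floor_eq_iff.2 hm
    have hp : (0 : ℝ) < 2 ^ j ^ 2 := by positivity
    have hinv : ((1 : ℝ) / 2) ^ j ^ 2 * 2 ^ j ^ 2 = 1 := by
      rw [← mul_pow]; norm_num
    have hnn : 0 ≤ (1 + Int.fract r) * 2 ^ j ^ 2 :=
      mul_nonneg (by linarith [Int.fract_nonneg r]) hp.le
    obtain ⟨h1, h2⟩ := (Nat.floor_eq_iff hnn).1 hr
    rw [← Int.self_sub_floor, hfl] at h1 h2
    constructor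
    · refine le_of_mul_le_mul_right ?_ hp
      calc (m - 1 + y * (1 / 2) ^ j ^ 2) * (2 : ℝ) ^ j ^ 2
          = (m - 1) * 2 ^ j ^ 2 + y * ((1 / 2) ^ j ^ 2 * 2 ^ j ^ 2) := by ring
        _ ≤ r * 2 ^ j ^ 2 := by rw [hinv]; linarith
    · refine lt_of_mul_lt_mul_right ?_ hp.le
      calc r * (2 : ℝ) ^ j ^ 2 < (m - 1) * 2 ^ j ^ 2 + (y + 1) * ((1 / 2) ^ j ^ 2 * 2 ^ j ^ 2) := by
            rw [hinv]; linarith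
        _ = (m - 1 + (y + 1) * (1 / 2) ^ j ^ 2) * 2 ^ j ^ 2 := by ring
  refine (measure_mono hsub).trans ?_
  rw [Real.volume_Ico]
  exact ENNReal.ofReal_le_ofReal (by linarith)

/-- The event that the `j`-th random point is connected by `f`, in either direction, to a number
that may be an earlier random point. -/
def Collision (f : ℕ → ℕ) (j : ℕ) : Set ℝ :=
  {r | ∃ x < 2 ^ ((j - 1) ^ 2 + 1), randomPoint r j = f x ∨ f (randomPoint r j) = x}

/-- A union bound over the possible earlier points; injectivity of `f` leaves only two values of
the `j`-th point for each of them. No independence of the points is needed. -/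
lemma volume_collision_le {f : ℕ → ℕ} (hf : Function.Injective f) (m : ℤ) (j : ℕ) :
    volume (Collision f (j + 1) ∩ Ico (m : ℝ) (m + 1)) ≤ ENNReal.ofReal (2 * (1 / 4) ^ j) := by
  have hsub : Collision f (j + 1) ∩ Ico (m : ℝ) (m + 1) ⊆ ⋃ x ∈ Finset.range (2 ^ (j ^ 2 + 1)),
      (({r | randomPoint r (j + 1) = f x} ∩ Ico (m : ℝ) (m + 1)) ∪
        ({r | randomPoint r (j + 1) = Function.invFun f x} ∩ Ico (m : ℝ) (m + 1))) := by
    rintro r ⟨⟨x, hx, h⟩, hm⟩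
    refine mem_biUnion (Finset.mem_coe.2 (Finset.mem_range.2 hx)) ?_
    rcases h with h | h
    · exact Or.inl ⟨h, hm⟩
    · refine Or.inr ⟨?_, hm⟩
      rw [← h, mem_ofPred_eq, Function.leftInverse_invFun hf]
  refine (measure_mono hsub).trans ((measure_biUnion_finset_le _ _).trans ?_)
  refine (Finset.sum_le_sum fun x _ => (measure_union_le _ _).trans
    (add_le_add (volume_randomPoint_eq_le m (j + 1) _) (volume_randomPoint_eq_le m (j + 1) _))).trans
      ?_
  rw [Finset.sum_const, Finset.card_range, nsmul_eq_mul, ← ENNReal.ofReal_add (by positivity)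
    (by positivity), ← ENNReal.ofReal_natCast, ← ENNReal.ofReal_mul (by positivity)]
  refine ENNReal.ofReal_le_ofReal (le_of_eq ?_)
  have h4 : ((1 : ℝ) / 4) ^ j = (1 / 2) ^ (2 * j) := by rw [pow_mul]; norm_num
  have h1 : (2 : ℝ) ^ j ^ 2 * (1 / 2) ^ j ^ 2 = 1 := by rw [← mul_pow]; norm_num
  have he : (j + 1) ^ 2 = j ^ 2 + 2 * j + 1 := by ring
  rw [h4, he]
  push_cast
  calc (2 : ℝ) ^ (j ^ 2 + 1) * ((1 / 2) ^ (j ^ 2 + 2 * j + 1) + (1 / 2) ^ (j ^ 2 + 2 * j + 1))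
      = 2 * (2 ^ j ^ 2 * (1 / 2) ^ j ^ 2) * (1 / 2) ^ (2 * j) := by ring
    _ = 2 * (1 / 2) ^ (2 * j) := by rw [h1, mul_one]

lemma starFree_randomSet (f : Square Function.Injective) {r : ℝ}
    (h : ∀ᶠ j in atTop, r ∉ Collision f.1 (j + 1)) : StarFree _ f (randomSet r) := by
  obtain ⟨J, hJ⟩ := eventually_atTop.1 h
  have hlt : ∀ i j, i < j → (randomPoint r j = f.1 (randomPoint r i) ∨
      f.1 (randomPoint r j) = randomPoint r i) → j ≤ J := by
    intro i j hij hc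
    by_contra! hJj
    obtain ⟨k, rfl⟩ : ∃ k, j = k + 1 := ⟨j - 1, by omega⟩
    exact hJ k (by omega) ⟨_, randomPoint_lt_of_lt r hij, hc⟩
  refine ((finite_Iic J).image (randomPoint r)).subset ?_
  rintro _ ⟨⟨_, ⟨i, rfl⟩, rfl⟩, ⟨j, hj⟩⟩
  refine ⟨j, ?_, hj⟩
  rcases lt_trichotomy i j with hij | rfl | hij
  · exact hlt i j hij (Or.inl hj)
  · exact absurd hj.symm (f.2.1 _)
  · exact hij.le.trans (hlt j i hij (Or.inr hj.symm))

/-- By the Borel–Cantelli lemma almost surely only finitely many collisions occur. -/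
lemma not_starFree_randomSet_mem_nullIdeal (f : Square Function.Injective) :
    {r | ¬ StarFree _ f (randomSet r)} ∈ nullIdeal := by
  have hnull : ∀ m : ℤ, volume
      (limsup (fun j => Collision f.1 (j + 1) ∩ Ico (m : ℝ) (m + 1)) atTop) = 0 := by
    refine fun m => measure_limsup_atTop_eq_zero (ne_top_of_le_ne_top ?_
      (ENNReal.tsum_le_tsum fun j => volume_collision_le f.2.2 m j))
    have hs : Summable fun j : ℕ => 2 * ((1 : ℝ) / 4) ^ j :=
      (summable_geometric_of_lt_one (by norm_num) (by norm_num)).mul_left 2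
    exact hs.tsum_ofReal_ne_top
  refine measure_mono_null ?_ (measure_iUnion_null hnull)
  intro r hr
  refine mem_iUnion.2 ⟨⌊r⌋, ?_⟩
  rw [mem_limsup_iff_frequently_mem]
  have hfreq : ∃ᶠ j in atTop, r ∈ Collision f.1 (j + 1) := fun hev =>
    hr (starFree_randomSet f hev)
  exact hfreq.mono fun j hj => ⟨hj, Int.floor_le r, Int.lt_floor_add_one r⟩

/-! ### Generic involutions -/

/-- Frequencies growing fast enough for `exists_Ioo_genericFun_eq_and_eq`. -/
def freq (n : ℕ) : ℕ := (n + 1).factorial ^ 3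

/-- A function which, for `r` in a sufficiently short interval that depends on `n`, still takes
every positive value at `n`. -/
noncomputable def genericFun (r : ℝ) (n : ℕ) : ℕ := ⌊1 / Int.fract (freq n * r)⌋₊

lemma freq_pos (n : ℕ) : 0 < freq n := pow_pos (Nat.factorial_pos _) 3

lemma le_freq (n : ℕ) : n ≤ freq n :=
  (Nat.le_succ n).trans ((Nat.self_le_factorial _).trans (Nat.le_self_pow (by norm_num) _))

lemma mul_freq_le {a b : ℕ} (hab : a < b) : 2 * (freq a * (b * (b + 1))) ≤ freq b := by
  have h1 : (a + 1).factorial ≤ b.factorial := Nat.factorial_le hab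
  have h2 : (a + 1).factorial ^ 3 ≤ b.factorial ^ 3 := Nat.pow_le_pow_left h1 3
  rw [freq, freq, Nat.factorial_succ b, mul_pow]
  have h3 : 2 * (b * (b + 1)) ≤ (b + 1) ^ 3 := by nlinarith [sq_nonneg (b : ℤ)]
  calc 2 * ((a + 1).factorial ^ 3 * (b * (b + 1)))
      = (2 * (b * (b + 1))) * (a + 1).factorial ^ 3 := by ring
    _ ≤ (b + 1) ^ 3 * b.factorial ^ 3 := Nat.mul_le_mul h3 h2

/-- Every interval of two periods contains an interval of known length on which the value at `n`
is `v`. -/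
lemma exists_Ioo_genericFun_eq (n : ℕ) {v : ℕ} (hv : 0 < v) (x : ℝ) :
    ∃ y, x ≤ y ∧ y + 1 / (freq n * (v * (v + 1))) ≤ x + 2 / freq n ∧
      ∀ r ∈ Ioo y (y + 1 / (freq n * (v * (v + 1)))), genericFun r n = v := by
  have hc : (0 : ℝ) < freq n := by exact_mod_cast freq_pos n
  have hv' : (1 : ℝ) ≤ v := by exact_mod_cast hv
  have hv0 : (0 : ℝ) < v := by linarith
  set c : ℝ := (freq n : ℝ) with hcdef
  set k : ℤ := ⌈c * x⌉
  have hk1 : c * x ≤ k := Int.le_ceil _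
  have hk2 : (k : ℝ) < c * x + 1 := Int.ceil_lt_add_one _
  -- The reciprocal of the fractional part lies in `(v, v + 1)` for `c * r` between
  -- `k + 1 / (v + 1)` and `k + 1 / v`.
  have hend : (k + 1 / (v + 1 : ℝ)) / c + 1 / (c * (v * (v + 1))) = (k + 1 / v) / c := by
    field_simp
    ring
  have hv1 : 1 / (v : ℝ) ≤ 1 := by rw [div_le_one hv0]; exact hv'
  refine ⟨(k + 1 / (v + 1 : ℝ)) / c, ?_, ?_, ?_⟩
  · rw [le_div_iff₀ hc]
    have : 0 < 1 / (v + 1 : ℝ) := by positivity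
    linarith
  · rw [hend, div_le_iff₀ hc, add_mul, div_mul_cancel₀ _ hc.ne']
    linarith
  · rw [hend]
    rintro r ⟨h1, h2⟩
    rw [div_lt_iff₀ hc] at h1
    rw [lt_div_iff₀ hc] at h2
    have hpos : 0 < 1 / (v + 1 : ℝ) := by positivity
    have hfl : ⌊c * r⌋ = k := Int.floor_eq_iff.2 ⟨by linarith, by linarith⟩
    have hfr : Int.fract (c * r) = r * c - k := by rw [← Int.self_sub_floor, hfl]; ring
    have hfpos : 0 < r * c - k := by linarith
    rw [genericFun, ← hcdef, hfr, Nat.floor_eq_iff (by positivity)]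
    constructor
    · rw [le_div_iff₀ hfpos]
      have : r * c - k ≤ 1 / v := by linarith
      calc (v : ℝ) * (r * c - k) ≤ v * (1 / v) := by gcongr
        _ = 1 := by field_simp
    · rw [div_lt_iff₀ hfpos]
      have : 1 / (v + 1 : ℝ) < r * c - k := by linarith
      calc (1 : ℝ) = (v + 1) * (1 / (v + 1)) := by field_simp
        _ < (v + 1) * (r * c - k) := by gcongr

/-- The interval on which the value at `a` is `b` still contains two periods of the function that
determines the value at `b`. -/
lemma exists_Ioo_genericFun_eq_and_eq {a b : ℕ} (ha : 0 < a) (hab : a < b) (x : ℝ) :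
    ∃ y z, x ≤ y ∧ y < z ∧ z ≤ x + 2 / freq a ∧
      ∀ r ∈ Ioo y z, genericFun r a = b ∧ genericFun r b = a := by
  obtain ⟨y, hxy, hy, hya⟩ := exists_Ioo_genericFun_eq a (ha.trans hab) x
  obtain ⟨z, hyz, hz, hzb⟩ := exists_Ioo_genericFun_eq b ha y
  have hfa : (0 : ℝ) < freq a := by exact_mod_cast freq_pos a
  have hfb : (0 : ℝ) < freq b := by exact_mod_cast freq_pos b
  have ha' : (0 : ℝ) < a := by exact_mod_cast ha
  have hb' : (0 : ℝ) < b := by exact_mod_cast ha.trans hab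
  have hle : 2 / (freq b : ℝ) ≤ 1 / (freq a * (b * (b + 1))) := by
    rw [div_le_div_iff₀ hfb (by positivity), one_mul]
    exact_mod_cast mul_freq_le hab
  refine ⟨z, z + 1 / (freq b * (a * (a + 1))), hxy.trans hyz, ?_, by linarith, fun r hr => ?_⟩
  · have : 0 < 1 / ((freq b : ℝ) * (a * (a + 1))) := by positivity
    linarith
  · exact ⟨hya r ⟨hyz.trans_lt hr.1, by linarith [hr.2]⟩, hzb r hr⟩

/-- If, for each `N`, every interval contains a subinterval on which `P N` holds, then generically
all `P N` hold. -/
lemma eventually_residual_forall {P : ℕ → ℝ → Prop}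
    (h : ∀ N x ε, 0 < ε → ∃ y z, x ≤ y ∧ y < z ∧ z ≤ x + ε ∧ ∀ r ∈ Ioo y z, P N r) :
    ∀ᶠ r in residual ℝ, ∀ N, P N r := by
  refine eventually_countable_forall.2 fun N => ?_
  refine mem_of_superset (residual_of_dense_open isOpen_interior ?_)
    (interior_subset (s := {r | P N r}))
  rw [Metric.dense_iff]
  intro x ε hε
  obtain ⟨y, z, hxy, hyz, hz, hP⟩ := h N x (ε / 2) (by positivity)
  refine ⟨(y + z) / 2, ?_, ?_⟩
  · rw [Metric.mem_ball, Real.dist_eq, abs_lt]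
    constructor <;> linarith
  · exact interior_maximal hP isOpen_Ioo ⟨by linarith, by linarith⟩

lemma exists_two_div_freq_le {ε : ℝ} (hε : 0 < ε) : ∃ M, ∀ n ≥ M, 2 / (freq n : ℝ) ≤ ε := by
  obtain ⟨M, hM⟩ := exists_nat_ge (2 / ε)
  refine ⟨M, fun n hn => ?_⟩
  have hfn : (0 : ℝ) < freq n := by exact_mod_cast freq_pos n
  have hMn : (M : ℝ) ≤ freq n := by exact_mod_cast hn.trans (le_freq n)
  rw [div_le_iff₀ hfn]
  rw [div_le_iff₀ hε] at hM
  nlinarith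

lemma eventually_residual_exists_swap (A : InfSet) : ∀ᶠ r in residual ℝ, ∀ N, ∃ a ∈ A.1,
    ∃ b ∈ A.1, N < a ∧ a < b ∧ genericFun r a = b ∧ genericFun r b = a := by
  refine eventually_residual_forall fun N x ε hε => ?_
  obtain ⟨M, hM⟩ := exists_two_div_freq_le hε
  obtain ⟨a, haA, ha⟩ := A.2.exists_gt (max N M)
  obtain ⟨b, hbA, hab⟩ := A.2.exists_gt a
  obtain ⟨y, z, hxy, hyz, hz, h⟩ := exists_Ioo_genericFun_eq_and_eq (by omega) hab x
  have := hM a (by omega)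
  exact ⟨y, z, hxy, hyz, by linarith, fun r hr => ⟨a, haA, b, hbA, by omega, hab, h r hr⟩⟩

lemma eventually_residual_exists_fixed :
    ∀ᶠ r in residual ℝ, ∀ N, ∃ a, N < a ∧ genericFun r a = a := by
  refine eventually_residual_forall fun N x ε hε => ?_
  obtain ⟨M, hM⟩ := exists_two_div_freq_le hε
  have hpos : 0 < max N M + 1 := by omega
  obtain ⟨y, hxy, hy, h⟩ := exists_Ioo_genericFun_eq (max N M + 1) hpos x
  have h1 := hM (max N M + 1) (by omega)
  have hf : (0 : ℝ) < freq (max N M + 1) := by exact_mod_cast freq_pos _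
  refine ⟨y, _, hxy, ?_, by linarith, fun r hr => ⟨max N M + 1, by omega, h r hr⟩⟩
  exact lt_add_of_pos_right y (by positivity)

/-- The points which `h` interchanges with another point. -/
def Swapped (h : ℕ → ℕ) : Set ℕ := {n | h n ≠ n ∧ h (h n) = n}

/-- The interchanges of `h` extend to an injection without fixed points once infinitely many
points are left, on which a copy of the successor function is used. -/
lemma exists_square_extending {h : ℕ → ℕ} (hinf : (Swapped h)ᶜ.Infinite) :
    ∃ f : Square Function.Injective, ∀ n ∈ Swapped h, f.1 n = h n := by
  classical
  have hswap : ∀ {n}, n ∈ Swapped h → h n ∈ Swapped h := fun {n} hn =>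
    ⟨by rw [hn.2]; exact hn.1.symm, by rw [hn.2]⟩
  have hI : Infinite ↥(Swapped h)ᶜ := hinf.to_subtype
  let e : ↥(Swapped h)ᶜ ≃ ℕ := (nonempty_equiv_of_countable).some
  let s : ↥(Swapped h)ᶜ → ↥(Swapped h)ᶜ := fun u => e.symm (e u + 1)
  have hs : ∀ u, s u ≠ u := fun u hu => by
    have := congrArg e hu
    simp [s] at this
  have hs' : Function.Injective s := fun u v huv => by
    simpa [s] using huv
  let f : ℕ → ℕ := fun n => if hn : n ∈ Swapped h then h n else s ⟨n, hn⟩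
  have hf1 : ∀ n, n ∈ Swapped h → f n = h n := fun n hn => dif_pos hn
  have hf2 : ∀ n (hn : n ∉ Swapped h), f n = s ⟨n, hn⟩ := fun n hn => dif_neg hn
  refine ⟨⟨f, fun n => ?_, fun m n hmn => ?_⟩, hf1⟩
  · by_cases hn : n ∈ Swapped h
    · rw [hf1 n hn]
      exact hn.1
    · rw [hf2 n hn]
      exact fun heq => hs _ (Subtype.ext heq)
  · by_cases hm : m ∈ Swapped h <;> by_cases hn : n ∈ Swapped h
    · rw [hf1 m hm, hf1 n hn] at hmn
      rw [← hm.2, hmn, hn.2]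
    · rw [hf1 m hm, hf2 n hn] at hmn
      exact absurd (hmn ▸ hswap hm) (s ⟨n, hn⟩).2
    · rw [hf2 m hm, hf1 n hn] at hmn
      exact absurd (hmn ▸ hswap hn) (s ⟨m, hm⟩).2
    · rw [hf2 m hm, hf2 n hn] at hmn
      exact congrArg Subtype.val (hs' (Subtype.ext hmn))

/-- Every real yields a member of `Square Function.Injective`; where the interchanges of
`genericFun r` do not extend to one, which happens on a meager set only, the choice is
arbitrary. -/
lemma exists_genericSquare (r : ℝ) : ∃ f : Square Function.Injective,
    (Swapped (genericFun r))ᶜ.Infinite → ∀ n ∈ Swapped (genericFun r), f.1 n = genericFun r n := by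
  by_cases hinf : (Swapped (genericFun r))ᶜ.Infinite
  · obtain ⟨f, hf⟩ := exists_square_extending hinf
    exact ⟨f, fun _ => hf⟩
  · exact ⟨⟨Nat.succ, Nat.succ_ne_self, Nat.succ_injective⟩, fun h => absurd h hinf⟩

/-- The injection attached to the real `r`. -/
noncomputable def genericSquare (r : ℝ) : Square Function.Injective :=
  (exists_genericSquare r).choose

/-- The injection of a generic real interchanges infinitely many pairs of elements of `A`. -/
lemma starFree_genericSquare_mem_meagerIdeal (A : InfSet) :
    {r | StarFree _ (genericSquare r) A} ∈ meagerIdeal := by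
  filter_upwards [eventually_residual_exists_swap A, eventually_residual_exists_fixed]
    with r hswap hfix hfree
  have hinf : (Swapped (genericFun r))ᶜ.Infinite := infinite_of_forall_exists_gt fun N => by
    obtain ⟨a, ha, hr⟩ := hfix N
    exact ⟨a, fun hs => hs.1 hr, ha⟩
  have hsq := (exists_genericSquare r).choose_spec hinf
  refine (infinite_of_forall_exists_gt fun N => ?_ :
    ((genericSquare r).1 '' A.1 ∩ A.1).Infinite) hfree
  obtain ⟨a, haA, b, hbA, hN, hab, h1, h2⟩ := hswap N
  have ha : a ∈ Swapped (genericFun r) := ⟨by omega, by rw [h1, h2]⟩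
  exact ⟨b, ⟨⟨a, haA, (hsq a ha).trans h1⟩, hbA⟩, hN.trans hab⟩

lemma univ_notMem_meagerIdeal : (univ : Set ℝ) ∉ meagerIdeal :=
  not_isMeagre_of_isOpen isOpen_univ univ_nonempty

lemma exists_not_starFree (A : InfSet) : ∃ f, ¬ StarFree Function.Injective f A := by
  by_contra! hcon
  refine univ_notMem_meagerIdeal ?_
  simpa [hcon] using starFree_genericSquare_mem_meagerIdeal A

end CardChar

theorem mainTheorem9 :
    (max (max CardChar.bNumber CardChar.sNumber) (CardChar.cov CardChar.nullIdeal)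
        ≤ CardChar.delta Function.Injective ∧
      CardChar.delta Function.Injective ≤ CardChar.non CardChar.meagerIdeal) ∧
    (CardChar.cov CardChar.meagerIdeal ≤ CardChar.ros Function.Injective ∧
      CardChar.ros Function.Injective
        ≤ min (min CardChar.dNumber CardChar.rNumber) (CardChar.non CardChar.nullIdeal)) := by
  open CardChar in
  refine ⟨⟨max_le (max_le ?_ (sNumber_le_delta exists_not_starFree)) ?_, ?_⟩, ?_,
    le_min (le_min ros_le_dNumber ros_le_rNumber) ?_⟩
  · exact unbNumber_le_unbNumber (fun f => twoSidedBound f.1) sparseSet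
      (fun f _ => starFree_sparseSet f) exists_not_starFree
  · exact cov_le_unbNumber randomSet not_starFree_randomSet_mem_nullIdeal exists_not_starFree
  · exact unbNumber_le_non (fun s hs t ht => IsMeagre.mono ht hs) univ_notMem_meagerIdeal
      genericSquare starFree_genericSquare_mem_meagerIdeal
  · exact cov_le_domNumber genericSquare starFree_genericSquare_mem_meagerIdeal exists_starFree
  · refine domNumber_le_non (fun s hs t ht => MeasureTheory.measure_mono_null ht hs) ?_
      randomSet not_starFree_randomSet_mem_nullIdeal
    simp [nullIdeal]
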